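/- For a positive integer $n$ let $[n]=\{1,2,\ldots,n\}$. The restriction $\sigma|_X$ of a permutation $\sigma$ of $[n]$ to a subset $X\subseteq[n]$ is called even if the number of its inversions, i.e. of pairs $a<b$ in $X$ such that the image of $a$ under $\sigma$ is greater than the image of $b$, is even. Let $\Gamma_n$ be the group of all permutations $\sigma$ of $[n]$ such that $\sigma|_X$ is even for every subset $X$ of $[n]$ with exactly $n-1$ elements. The rank of a group is the minimum size of a generating set. In cycle notation, let $$\sigma_n=(1,2,\ldots,n),\qquad \theta_n=(1,3)(2,4)\quad(n\geq 4),$$ and, for odd $n\geq 5$, $$\eta_n=(3,5,\ldots,n)(2,4,\ldots,n-1),\qquad \zeta_n=(1,3,\ldots,n)(4,6,\ldots,n-1).$$ **Theorem.** 1. If $n$ is odd and $n=5$ or $n\geq 9$, then $\Gamma_n=\langle\theta_n,\eta_n\rangle=\langle\theta_n,\zeta_n\rangle$ and $\Gamma_n$ has rank $2$. 2. If $n$ is even and $n\geq 6$, then $\Gamma_n=\langle\theta_n,\sigma_n\rangle$ and $\Gamma_n$ has rank $2$. 3. $\Gamma_4$ is the cyclic group of order $4$ generated by $\sigma_4$.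 4. $\Gamma_7=\langle(1,3)(2,4),(3,5,7),(2,4,6)\rangle$ and $\Gamma_7$ has rank $3$. -/

import Mathlib

namespace EvenRestriction

open Equiv

/-- The inversions of the restriction of the permutation `σ` to `X`: pairs `a < b` in `X` with
`σ b < σ a`.  Throughout, `[n] = {1, …, n}` is modelled by `Fin n`, the point `k ∈ [n]` being the
element of `Fin n` with value `k - 1`. -/
def inversionsOn {n : ℕ} (σ : Perm (Fin n)) (X : Finset (Fin n)) : Finset (Fin n × Fin n) :=
  (X ×ˢ X).filter fun p => p.1 < p.2 ∧ σ p.2 < σ p.1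

/-- The restriction of `σ` to `X` is an even partial permutation. -/
def IsEvenOn {n : ℕ} (σ : Perm (Fin n)) (X : Finset (Fin n)) : Prop :=
  Even (inversionsOn σ X).card

/-- Inversion indicator of an unordered pair, mod 2. -/
def invWeight {n : ℕ} (σ : Perm (Fin n)) (a b : Fin n) : ZMod 2 :=
  if (a < b ↔ σ a < σ b) then 0 else 1

theorem invWeight_comm {n : ℕ} (σ : Perm (Fin n)) (a b : Fin n) :
    invWeight σ a b = invWeight σ b a := by
  rcases eq_or_ne a b with rfl | h
  · rfl
  · have h' : σ a ≠ σ b := fun e => h (σ.injective e)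
    unfold invWeight
    congr 1
    apply propext
    grind

theorem invWeight_mul {n : ℕ} (σ τ : Perm (Fin n)) (a b : Fin n) :
    invWeight (σ * τ) a b = invWeight τ a b + invWeight σ (τ a) (τ b) := by
  have h2 : (1 : ZMod 2) + 1 = 0 := by decide
  unfold invWeight
  rw [Perm.mul_apply, Perm.mul_apply]
  by_cases h₁ : a < b <;> by_cases h₃ : τ a < τ b <;> by_cases h₄ : σ (τ a) < σ (τ b) <;>
    simp [h₁, h₃, h₄, h2]

theorem card_inversionsOn {n : ℕ} (σ : Perm (Fin n)) (X : Finset (Fin n)) :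
    ((inversionsOn σ X).card : ZMod 2) =
      ∑ p ∈ (X ×ˢ X).filter (fun p => p.1 < p.2), invWeight σ p.1 p.2 := by
  have h : inversionsOn σ X =
      ((X ×ˢ X).filter (fun p => p.1 < p.2)).filter (fun p => σ p.2 < σ p.1) := by
    ext p; simp [inversionsOn, and_assoc]
  rw [h, Finset.card_filter, Nat.cast_sum]
  refine Finset.sum_congr rfl fun p hp => ?_
  have hp' : p.1 < p.2 := (Finset.mem_filter.1 hp).2
  have hne : σ p.1 ≠ σ p.2 := fun e => hp'.ne (σ.injective e)
  rcases lt_or_gt_of_ne hne with h' | h' <;> simp [invWeight, hp', h', h'.not_gt]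

theorem sum_invWeight_map {n : ℕ} (σ τ : Perm (Fin n)) (X : Finset (Fin n)) :
    ∑ p ∈ (X ×ˢ X).filter (fun p => p.1 < p.2), invWeight σ (τ p.1) (τ p.2) =
      ∑ p ∈ ((X.map τ.toEmbedding) ×ˢ (X.map τ.toEmbedding)).filter (fun p => p.1 < p.2),
        invWeight σ p.1 p.2 := by
  refine Finset.sum_bij'
    (fun p _ => (min (τ p.1) (τ p.2), max (τ p.1) (τ p.2)))
    (fun p _ => (min (τ.symm p.1) (τ.symm p.2), max (τ.symm p.1) (τ.symm p.2))) ?_ ?_ ?_ ?_ ?_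
  · rintro ⟨a, b⟩ h
    simp only [Finset.mem_filter, Finset.mem_product] at h
    have hne : τ a ≠ τ b := fun e => h.2.ne (τ.injective e)
    rcases lt_or_gt_of_ne hne with h' | h' <;>
      simp [h'.le, h', h.1.1, h.1.2]
  · rintro ⟨a, b⟩ h
    simp only [Finset.mem_filter, Finset.mem_product, Finset.mem_map_equiv] at h
    have hne : τ.symm a ≠ τ.symm b := fun e => h.2.ne (τ.symm.injective e)
    rcases lt_or_gt_of_ne hne with h' | h' <;>
      simp [h'.le, h', h.1.1, h.1.2]
  · rintro ⟨a, b⟩ h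
    simp only [Finset.mem_filter, Finset.mem_product] at h
    have hne : τ a ≠ τ b := fun e => h.2.ne (τ.injective e)
    rcases lt_or_gt_of_ne hne with h' | h' <;> simp [h'.le, h.2.le]
  · rintro ⟨a, b⟩ h
    simp only [Finset.mem_filter, Finset.mem_product] at h
    have hne : τ.symm a ≠ τ.symm b := fun e => h.2.ne (τ.symm.injective e)
    rcases lt_or_gt_of_ne hne with h' | h' <;> simp [h'.le, h.2.le]
  · rintro ⟨a, b⟩ h
    rcases le_total (τ a) (τ b) with h' | h'
    · simp [h']
    · simp [h', invWeight_comm σ (τ a) (τ b)]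

theorem card_inversionsOn_mul {n : ℕ} (σ τ : Perm (Fin n)) (X : Finset (Fin n)) :
    ((inversionsOn (σ * τ) X).card : ZMod 2) =
      (inversionsOn τ X).card + (inversionsOn σ (X.map τ.toEmbedding)).card := by
  rw [card_inversionsOn, card_inversionsOn, card_inversionsOn, ← sum_invWeight_map,
    ← Finset.sum_add_distrib]
  exact Finset.sum_congr rfl fun p _ => invWeight_mul σ τ p.1 p.2

theorem isEvenOn_iff {n : ℕ} (σ : Perm (Fin n)) (X : Finset (Fin n)) :
    IsEvenOn σ X ↔ ((inversionsOn σ X).card : ZMod 2) = 0 :=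
  (ZMod.natCast_eq_zero_iff_even).symm

theorem isEvenOn_one {n : ℕ} (X : Finset (Fin n)) : IsEvenOn (1 : Perm (Fin n)) X := by
  rw [isEvenOn_iff, card_inversionsOn]
  exact Finset.sum_eq_zero fun p _ => by simp [invWeight]

/-- The group of permutations of `[n]` all of whose restrictions to `t`-element subsets are
even. -/
def GammaWidth (n t : ℕ) : Subgroup (Perm (Fin n)) where
  carrier := {σ | ∀ X : Finset (Fin n), X.card = t → IsEvenOn σ X}
  one_mem' := fun X _ => isEvenOn_one X
  mul_mem' := by
    intro σ τ hσ hτ X hX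
    have h₁ := (isEvenOn_iff _ _).1 (hτ X hX)
    have h₂ := (isEvenOn_iff _ _).1 (hσ (X.map τ.toEmbedding) (by rw [Finset.card_map, hX]))
    rw [isEvenOn_iff, card_inversionsOn_mul, h₁, h₂, add_zero]
  inv_mem' := by
    intro σ hσ X hX
    have h₁ := (isEvenOn_iff _ _).1
      (hσ (X.map (σ⁻¹).toEmbedding) (by rw [Finset.card_map, hX]))
    have h₂ := card_inversionsOn_mul σ σ⁻¹ X
    rw [mul_inv_cancel, (isEvenOn_iff _ _).1 (isEvenOn_one X), h₁, add_zero] at h₂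
    exact (isEvenOn_iff _ _).2 h₂.symm

/-- `Γ_n`: the permutations of `[n]` all of whose restrictions to the maximal proper subsets of
`[n]` are even. -/
def Gamma (n : ℕ) : Subgroup (Perm (Fin n)) := GammaWidth n (n - 1)

/-- The cycle `(k₁, k₂, …, kᵣ)` on `[n]` (a product of cycles is written as a product), where the
list of distinct labels is taken from `{1, …, n}`; the label `k` is the element of `Fin n` with
value `k - 1`.  Labels outside `{1, …, n}` would be ignored. -/
def cyc (n : ℕ) (l : List ℕ) : Perm (Fin n) :=
  (l.filterMap fun k =>
    if h : 1 ≤ k ∧ k ≤ n then some (⟨k - 1, by omega⟩ : Fin n) else none).formPerm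

/-- `σ_n = (1, 2, …, n)`. -/
def sigma (n : ℕ) : Perm (Fin n) := finRotate n

/-- `θ_n = (1, 3)(2, 4)`, for `n ≥ 4`. -/
def theta (n : ℕ) : Perm (Fin n) := cyc n [1, 3] * cyc n [2, 4]

/-- `η_n = (3, 5, …, n)(2, 4, …, n - 1)`, for odd `n ≥ 5`
(`List.range' a m 2` is `[a, a + 2, …, a + 2 (m - 1)]`). -/
def eta (n : ℕ) : Perm (Fin n) :=
  cyc n (List.range' 3 ((n - 1) / 2) 2) * cyc n (List.range' 2 ((n - 1) / 2) 2)

/-- `ζ_n = (1, 3, …, n)(4, 6, …, n - 1)`, for odd `n ≥ 5`. -/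
def zeta (n : ℕ) : Perm (Fin n) :=
  cyc n (List.range' 1 ((n + 1) / 2) 2) * cyc n (List.range' 4 ((n - 3) / 2) 2)

end EvenRestriction

/-!
The number of inversions of `σ` that involve a given point `i` is congruent to `σ i - i` mod 2, so
deleting `i` turns the parity of `σ` into that of `σ` plus the displacement of `i`. Hence `σ` lies
in `Γ_n` if and only if every displacement has the parity of `σ` (`mem_Gamma_iff`): either `σ` is even
and preserves the two parity classes of points, or `σ` is odd and interchanges them. For odd `n` the
second case cannot occur, because the displacements add up to `0`. So, inside the product of the
symmetric groups on the two classes, the even part of `Γ_n` is the subgroup `H` of pairs of equal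
sign.

A subgroup of `H` that maps onto both factors and contains a 3-cycle of one class is all of `H`
(`mem_of_isThreeCycle`). In every case the even elements generated by the proposed generators map
onto both factors, since a full cycle and a transposition of two consecutive points generate a
symmetric group. The 3-cycle is found as follows. For even `n`, conjugating `θ_n` by `σ_n` gives
`(2,4)(3,5)`, and the product with `θ_n` moves only `1, 3, 5`; the odd elements of `Γ_n` are then
obtained by multiplication with `σ_n`. For odd `n ≥ 9`, the conjugate of `θ_n` by `η_n ^ 2` is `(1,7)(6,8)`, and the
square of its product with `θ_n` is a 3-cycle on `1, 3, 7`. For `n = 5`, the product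
`θ_n η_n = ζ_n` is a 3-cycle; for `n = 7` one is given. The relation `θ_n η_n = ζ_n` makes the two
generating pairs for odd `n` equivalent. As the generators do not commute, the rank is `2`.

For `n = 7`, the group `H` has twelve distinct homomorphisms to the symmetric group `S_3` that
preserve signs: those given by the quotient `S_4 → S_3` and by the second factor `S_3`, followed by
inner automorphisms. Two elements of prescribed signs have only `9` pairs of images, so two of the
homomorphisms agree on them and the elements do not generate `H`: the rank is at least `3`
(`two_lt_rank_equalSign`).
-/

namespace EvenRestriction

open Equiv

/-! ### Membership in `Γ_n` through displacements -/

theorem sign_eq_neg_one_pow_card_inversionsOn {n : ℕ} (σ : Perm (Fin n)) :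
    Perm.sign σ = (-1) ^ (inversionsOn σ Finset.univ).card := by
  have h : ∏ p ∈ inversionsOn σ Finset.univ, (-1 : ℤˣ) =
      ∏ i, ∏ j, if i < j ∧ σ j < σ i then (-1 : ℤˣ) else 1 := by
    rw [inversionsOn, Finset.prod_filter, Finset.univ_product_univ, ← Finset.univ_product_univ,
      Finset.prod_product]
  rw [← Finset.prod_const, h, Perm.sign_eq_prod_prod_Ioi]
  refine Finset.prod_congr rfl fun i _ => ?_
  rw [← Finset.filter_lt_eq_Ioi, Finset.prod_filter]
  refine Finset.prod_congr rfl fun j _ => ?_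
  by_cases hij : i < j
  · have hne : σ i ≠ σ j := fun e => hij.ne (σ.injective e)
    rcases lt_or_gt_of_ne hne with h' | h' <;> simp [hij, h', h'.not_gt]
  · simp [hij]

/-- The pairs through `i` inverted by `σ` are, mod 2, as many as the displacement of `i`: there are
`n - 1 - i` points above `i` and `n - 1 - σ i` points above `σ i`, and a pair `{i, j}` is inverted
exactly when `j` counts in one of these two sets only. -/
theorem sum_invWeight_right {n : ℕ} (σ : Perm (Fin n)) (i : Fin n) :
    ∑ j, invWeight σ i j = ((σ i : ℕ) + (i : ℕ) : ZMod 2) := by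
  have h2 : (1 : ZMod 2) + 1 = 0 := by decide
  have h₁ : ∀ j, invWeight σ i j = (if i < j then 1 else 0) + (if σ i < σ j then 1 else 0) := by
    intro j
    by_cases h : i < j <;> by_cases h' : σ i < σ j <;> simp [invWeight, h, h', h2]
  have h₃ : ∀ i : Fin n, ∑ j, (if i < j then (1 : ZMod 2) else 0) = ((n - 1 - i : ℕ) : ZMod 2) := by
    intro i
    rw [Finset.sum_boole, Finset.filter_lt_eq_Ioi, Fin.card_Ioi]
  have h₄ : ∑ j, (if σ i < σ j then (1 : ZMod 2) else 0) = ((n - 1 - σ i : ℕ) : ZMod 2) := by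
    rw [← h₃]
    exact Equiv.sum_comp σ fun j => if σ i < j then (1 : ZMod 2) else 0
  rw [Finset.sum_congr rfl fun j _ => h₁ j, Finset.sum_add_distrib, h₃, h₄]
  have := i.isLt
  have := (σ i).isLt
  norm_cast
  rw [ZMod.natCast_eq_natCast_iff']
  omega

theorem card_inversionsOn_erase {n : ℕ} (σ : Perm (Fin n)) (i : Fin n) :
    ((inversionsOn σ (Finset.univ.erase i)).card : ZMod 2) =
      (inversionsOn σ Finset.univ).card + ((σ i : ℕ) + (i : ℕ)) := by
  have h2 : ∀ x : ZMod 2, x + x = 0 := by decide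
  have key : ((inversionsOn σ Finset.univ).card : ZMod 2) =
      (inversionsOn σ (Finset.univ.erase i)).card + ∑ j, invWeight σ i j := by
    rw [card_inversionsOn, card_inversionsOn, Finset.sum_filter, Finset.sum_filter,
      Finset.sum_product, Finset.sum_product]
    have hstar : ∑ j, invWeight σ i j =
        ∑ a, ∑ b, ((if a = i then (if a < b then invWeight σ a b else 0) else 0) +
          if b = i then (if a < b then invWeight σ a b else 0) else 0) := by
      simp_rw [Finset.sum_add_distrib]
      rw [Finset.sum_comm]
      simp only [Finset.sum_ite_eq', Finset.mem_univ, if_true]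
      rw [← Finset.sum_add_distrib]
      refine Finset.sum_congr rfl fun j _ => ?_
      rcases lt_trichotomy i j with h | rfl | h
      · simp [h, h.not_gt]
      · simp [invWeight]
      · simp [h, h.not_gt, invWeight_comm σ i j]
    have herase : ∀ f : Fin n → ZMod 2, ∑ a ∈ Finset.univ.erase i, f a =
        ∑ a, if a = i then 0 else f a := by
      intro f
      rw [← Finset.filter_ne' Finset.univ i, Finset.sum_filter]
      exact Finset.sum_congr rfl fun a _ => by by_cases h : a = i <;> simp [h]
    rw [hstar, herase, ← Finset.sum_add_distrib]
    refine Finset.sum_congr rfl fun a _ => ?_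
    rw [herase]
    by_cases ha : a = i
    · subst ha
      simp only [if_true, zero_add]
      refine Finset.sum_congr rfl fun b _ => ?_
      by_cases hb : b = a
      · simp [hb]
      · simp [hb]
    · simp only [ha, if_false, zero_add, ← Finset.sum_add_distrib]
      refine Finset.sum_congr rfl fun b _ => ?_
      by_cases hb : b = i <;> simp [hb]
  rw [key, sum_invWeight_right, add_assoc, h2, add_zero]

/-- A permutation lies in `Γ_n` if and only if all displacements `σ i - i` have the parity of
`σ`. -/
theorem mem_Gamma_iff {n : ℕ} (hn : 0 < n) (σ : Perm (Fin n)) :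
    σ ∈ Gamma n ↔ ∀ i, Perm.sign σ = (-1) ^ ((σ i : ℕ) + (i : ℕ)) := by
  have h₁ : ∀ i, IsEvenOn σ (Finset.univ.erase i) ↔
      Perm.sign σ = (-1) ^ ((σ i : ℕ) + (i : ℕ)) := by
    intro i
    rw [isEvenOn_iff, card_inversionsOn_erase, sign_eq_neg_one_pow_card_inversionsOn]
    norm_cast
    rw [ZMod.natCast_eq_zero_iff_even, Nat.even_add]
    rcases Nat.even_or_odd (inversionsOn σ Finset.univ).card with h | h <;>
      rcases Nat.even_or_odd ((σ i : ℕ) + (i : ℕ)) with h' | h' <;>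
      simp [h.neg_one_pow, h'.neg_one_pow, h, h', ← Nat.not_odd_iff_even]
  constructor
  · intro h i
    exact (h₁ i).1 (h _ (by simp))
  · intro h X hX
    obtain ⟨i, hi⟩ : ∃ i, Xᶜ = {i} := by
      rw [← Finset.card_eq_one, Finset.card_compl, hX, Fintype.card_fin]
      omega
    have : X = Finset.univ.erase i := by
      rw [← compl_compl X, hi]
      ext
      simp
    rw [this]
    exact (h₁ i).2 (h i)

/-! ### Subgroups of a product of two symmetric groups -/

/-- Goursat-type argument: a subgroup of `Perm α × Perm β` which maps onto both factors, consists
of pairs of permutations of equal sign and contains a 3-cycle of the first factor, contains all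
such pairs. Conjugation yields all 3-cycles of `α`, hence the alternating group on `α`; any pair of
equal signs then differs from a pair in the subgroup by an even permutation of `α`. -/
theorem mem_of_isThreeCycle {α β : Type*} [Fintype α] [DecidableEq α] [Fintype β] [DecidableEq β]
    {K : Subgroup (Perm α × Perm β)} (hK : ∀ g ∈ K, Perm.sign g.1 = Perm.sign g.2)
    (h₁ : K.map (MonoidHom.fst _ _) = ⊤) (h₂ : K.map (MonoidHom.snd _ _) = ⊤)
    {c : Perm α} (hc : c.IsThreeCycle) (hcK : (c, 1) ∈ K)
    (g : Perm α × Perm β) (hg : Perm.sign g.1 = Perm.sign g.2) : g ∈ K := by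
  have halt : ∀ x : Perm α, Perm.sign x = 1 → (x, (1 : Perm β)) ∈ K := by
    have hle : alternatingGroup α ≤ K.comap (MonoidHom.inl _ _) := by
      rw [← Perm.closure_three_cycles_eq_alternating, Subgroup.closure_le]
      intro d hd
      obtain ⟨t, ht⟩ := isConj_iff.1 (Perm.isConj_iff_cycleType_eq.2
        ((show c.cycleType = {3} from hc).trans (show d.cycleType = {3} from hd).symm))
      obtain ⟨⟨t', u⟩, htu, rfl : t' = t⟩ := (h₁ ▸ Subgroup.mem_top t :
        t ∈ K.map (MonoidHom.fst _ _))
      have := K.mul_mem (K.mul_mem htu hcK) (K.inv_mem htu)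
      simpa [ht] using this
    exact fun x hx => hle (Perm.mem_alternatingGroup.2 hx)
  obtain ⟨x, y⟩ := g
  obtain ⟨⟨x', y'⟩, hxy, rfl : y' = y⟩ := (h₂ ▸ Subgroup.mem_top y :
    y ∈ K.map (MonoidHom.snd _ _))
  have hs : Perm.sign (x * x'⁻¹) = 1 := by
    have h' := hK _ hxy
    simp only at hg h'
    rw [map_mul, hg, ← h', map_inv, mul_inv_cancel]
  simpa using K.mul_mem (halt _ hs) hxy

theorem map_closure_eq_top {G H : Type*} [Group G] [Group H] (f : G →* H) {K : Subgroup G}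
    {a b : G} (ha : a ∈ K) (hb : b ∈ K) (h : Subgroup.closure {f a, f b} = ⊤) :
    K.map f = ⊤ := by
  rw [eq_top_iff, ← h, Subgroup.closure_le]
  rintro _ (rfl | rfl)
  exacts [⟨a, ha, rfl⟩, ⟨b, hb, rfl⟩]

/-! ### Ranks -/

theorem rank_eq_two {G : Type*} [Group G] {H : Subgroup G} [Group.FG H] {a b : G}
    (h : H = Subgroup.closure {a, b}) (hab : a * b ≠ b * a) : Group.rank H = 2 := by
  classical
  subst h
  have ha : a ∈ Subgroup.closure {a, b} := Subgroup.subset_closure (by simp)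
  have hb : b ∈ Subgroup.closure {a, b} := Subgroup.subset_closure (by simp)
  refine le_antisymm ?_ (Nat.lt_of_not_le fun hle => hab ?_)
  · have h₁ := Subgroup.rank_closure_finite_le_nat_card ({a, b} : Set G)
    refine h₁.trans ?_
    rw [Nat.card_coe_set_eq]
    exact (Set.ncard_insert_le a {b}).trans (by rw [Set.ncard_singleton])
  · obtain ⟨S, hS, hS'⟩ := Group.rank_spec (Subgroup.closure ({a, b} : Set G))
    obtain ⟨s, hs⟩ : ∃ s : Subgroup.closure ({a, b} : Set G), S ⊆ {s} :=
      Finset.card_le_one_iff_subset_singleton.1 (hS.trans_le hle)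
    have htop : ∀ t, t ∈ Subgroup.zpowers s := by
      rw [← Subgroup.eq_top_iff', eq_top_iff, ← hS', Subgroup.zpowers_eq_closure]
      exact Subgroup.closure_mono (by exact_mod_cast hs)
    obtain ⟨m, hm⟩ := Subgroup.mem_zpowers_iff.1 (htop ⟨a, ha⟩)
    obtain ⟨k, hk⟩ := Subgroup.mem_zpowers_iff.1 (htop ⟨b, hb⟩)
    have hcomm := (Commute.zpow_zpow (Commute.refl s) m k).eq
    rw [hm, hk] at hcomm
    exact congrArg Subtype.val hcomm

/-! ### Permutations preserving the parity of the points -/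

/-- The bijection placing the points of `Fin p` at the even values `0, 2, …` of `Fin (p + q)` (the
odd labels of `[p + q]`) and those of `Fin q` at the odd values `1, 3, …`; it exists when `p` is `q`
or `q + 1`. -/
noncomputable def interleave {p q : ℕ} (hqp : q ≤ p) (hpq : p ≤ q + 1) :
    Fin p ⊕ Fin q ≃ Fin (p + q) :=
  Equiv.ofBijective
    (Sum.elim (fun i => ⟨2 * i, by omega⟩) (fun i => ⟨2 * i + 1, by omega⟩)) <| by
      rw [Fintype.bijective_iff_injective_and_card]
      refine ⟨?_, by simp⟩
      rintro (i | i) (j | j) h <;> simp [Fin.ext_iff] at h ⊢ <;> omega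

section

variable {p q : ℕ} (hqp : q ≤ p) (hpq : p ≤ q + 1)

@[simp] theorem interleave_inl (i : Fin p) : (interleave hqp hpq (Sum.inl i) : ℕ) = 2 * i := rfl

@[simp] theorem interleave_inr (i : Fin q) : (interleave hqp hpq (Sum.inr i) : ℕ) = 2 * i + 1 := rfl

/-- The permutation of `Fin (p + q)` acting by `g.1` on the even values and by `g.2` on the odd
values. -/
noncomputable def blockPerm : Perm (Fin p) × Perm (Fin q) →* Perm (Fin (p + q)) :=
  (permCongrHom (interleave hqp hpq)).toMonoidHom.comp (Perm.sumCongrHom _ _)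

theorem blockPerm_apply (g : Perm (Fin p) × Perm (Fin q)) :
    blockPerm hqp hpq g = (interleave hqp hpq).permCongr (Perm.sumCongr g.1 g.2) := rfl

@[simp] theorem blockPerm_inl (g : Perm (Fin p) × Perm (Fin q)) (i : Fin p) :
    blockPerm hqp hpq g (interleave hqp hpq (Sum.inl i)) =
      interleave hqp hpq (Sum.inl (g.1 i)) := by
  simp [blockPerm_apply]

@[simp] theorem blockPerm_inr (g : Perm (Fin p) × Perm (Fin q)) (i : Fin q) :
    blockPerm hqp hpq g (interleave hqp hpq (Sum.inr i)) =
      interleave hqp hpq (Sum.inr (g.2 i)) := by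
  simp [blockPerm_apply]

theorem sign_blockPerm (g : Perm (Fin p) × Perm (Fin q)) :
    Perm.sign (blockPerm hqp hpq g) = Perm.sign g.1 * Perm.sign g.2 := by
  rw [blockPerm_apply, Perm.sign_permCongr, Perm.sign_sumCongr]

theorem blockPerm_injective : Function.Injective (blockPerm hqp hpq) :=
  (permCongrHom (interleave hqp hpq)).injective.comp Perm.sumCongrHom_injective

theorem even_blockPerm_add (g : Perm (Fin p) × Perm (Fin q)) (i : Fin (p + q)) :
    Even ((blockPerm hqp hpq g i : ℕ) + i) := by
  obtain ⟨i | i, rfl⟩ := (interleave hqp hpq).surjective i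
  · rw [blockPerm_inl, interleave_inl, interleave_inl]
    exact ⟨g.1 i + i, by omega⟩
  · rw [blockPerm_inr, interleave_inr, interleave_inr]
    exact ⟨g.2 i + i + 1, by omega⟩

theorem blockPerm_mem_Gamma_iff (hp : 0 < p) (g : Perm (Fin p) × Perm (Fin q)) :
    blockPerm hqp hpq g ∈ Gamma (p + q) ↔ Perm.sign g.1 = Perm.sign g.2 := by
  have h : Perm.sign g.1 * Perm.sign g.2 = 1 ↔ Perm.sign g.1 = Perm.sign g.2 := by
    rw [mul_eq_one_iff_eq_inv, Int.units_inv_eq_self]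
  rw [mem_Gamma_iff (by omega), ← h, sign_blockPerm]
  simp only [(even_blockPerm_add hqp hpq g _).neg_one_pow]
  exact ⟨fun h => h ⟨0, by omega⟩, fun h _ => h⟩

theorem exists_blockPerm_eq {σ : Perm (Fin (p + q))} (hσ : ∀ i, Even ((σ i : ℕ) + i)) :
    ∃ g, blockPerm hqp hpq g = σ := by
  have hmaps : Set.MapsTo ((interleave hqp hpq).symm.permCongr σ)
      (Set.range Sum.inl) (Set.range Sum.inl) := by
    rintro _ ⟨i, rfl⟩
    have h := hσ (interleave hqp hpq (Sum.inl i))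
    obtain ⟨j | j, hj⟩ := (interleave hqp hpq).surjective (σ (interleave hqp hpq (Sum.inl i)))
    · exact ⟨j, by simp [← hj]⟩
    · rw [← hj, interleave_inr, interleave_inl, Nat.even_iff] at h
      omega
  obtain ⟨g, hg⟩ := Perm.mem_sumCongrHom_range_of_perm_mapsTo_inl hmaps
  refine ⟨g, ?_⟩
  change (interleave hqp hpq).permCongr (Perm.sumCongrHom _ _ g) = σ
  rw [hg]
  ext i
  simp

/-! ### Cycles as permutations of one parity class -/

/-- A homomorphism taking transpositions to transpositions along `g` takes cycles to cycles along
`g`. -/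
theorem map_formPerm {α β : Type*} [DecidableEq α] [DecidableEq β] (f : Perm α →* Perm β)
    (g : α → β) (hfg : ∀ x y, f (swap x y) = swap (g x) (g y)) :
    ∀ l : List α, f l.formPerm = (l.map g).formPerm
  | [] => by simp
  | [x] => by simp
  | x :: y :: l => by
    rw [List.formPerm_cons_cons, map_mul, hfg, map_formPerm f g hfg (y :: l)]
    simp

theorem blockPerm_swap_inl (x y : Fin p) : blockPerm hqp hpq (swap x y, 1) =
    swap (interleave hqp hpq (Sum.inl x)) (interleave hqp hpq (Sum.inl y)) := by
  ext i
  obtain ⟨i | i, rfl⟩ := (interleave hqp hpq).surjective i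
  · simp only [blockPerm_inl, swap_apply_def, EmbeddingLike.apply_eq_iff_eq, Sum.inl.injEq]
    split_ifs <;> rfl
  · simp [swap_apply_def]

theorem blockPerm_swap_inr (x y : Fin q) : blockPerm hqp hpq (1, swap x y) =
    swap (interleave hqp hpq (Sum.inr x)) (interleave hqp hpq (Sum.inr y)) := by
  ext i
  obtain ⟨i | i, rfl⟩ := (interleave hqp hpq).surjective i
  · simp [swap_apply_def]
  · simp only [blockPerm_inr, swap_apply_def, EmbeddingLike.apply_eq_iff_eq, Sum.inr.injEq]
    split_ifs <;> rfl

theorem cyc_map_val {n : ℕ} (l : List (Fin n)) :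
    cyc n (l.map fun i : Fin n => (i : ℕ) + 1) = l.formPerm := by
  unfold cyc
  rw [List.filterMap_map]
  congr 1
  conv_rhs => rw [← List.filterMap_some (l := l)]
  refine List.filterMap_congr fun i _ => ?_
  have h : (i : ℕ) + 1 ≤ n := i.isLt
  simp [h]

theorem blockPerm_formPerm_inl (l : List (Fin p)) : blockPerm hqp hpq (l.formPerm, 1) =
    cyc (p + q) ((l.map fun i : Fin _ => (i : ℕ)).map fun i => 2 * i + 1) := by
  have h := map_formPerm ((blockPerm hqp hpq).comp (MonoidHom.inl _ _))
    (fun i => interleave hqp hpq (Sum.inl i)) (blockPerm_swap_inl hqp hpq) l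
  refine Eq.trans h ?_
  rw [← cyc_map_val, List.map_map, List.map_map]
  rfl

theorem blockPerm_formPerm_inr (l : List (Fin q)) : blockPerm hqp hpq (1, l.formPerm) =
    cyc (p + q) ((l.map fun i : Fin _ => (i : ℕ)).map fun i => 2 * i + 2) := by
  have h := map_formPerm ((blockPerm hqp hpq).comp (MonoidHom.inr _ _))
    (fun i => interleave hqp hpq (Sum.inr i)) (blockPerm_swap_inr hqp hpq) l
  refine Eq.trans h ?_
  rw [← cyc_map_val, List.map_map, List.map_map]
  rfl

theorem blockPerm_formPerm (l : List (Fin p)) (l' : List (Fin q)) :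
    blockPerm hqp hpq (l.formPerm, l'.formPerm) =
      cyc (p + q) ((l.map fun i : Fin _ => (i : ℕ)).map fun i => 2 * i + 1) *
        cyc (p + q) ((l'.map fun i : Fin _ => (i : ℕ)).map fun i => 2 * i + 2) := by
  rw [← blockPerm_formPerm_inl hqp hpq, ← blockPerm_formPerm_inr hqp hpq, ← map_mul]
  simp

theorem map_val_finRange (n : ℕ) :
    (List.finRange n).map (fun i : Fin n => (i : ℕ)) = List.range' 0 n := by
  rw [← List.range_eq_range']
  exact List.map_coe_finRange_eq_range

theorem map_val_tail_finRange (n : ℕ) :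
    (List.finRange n).tail.map (fun i : Fin n => (i : ℕ)) = List.range' 1 (n - 1) := by
  rw [List.map_tail, map_val_finRange]
  cases n <;> simp [List.range'_succ]

theorem map_range'_two_mul (a s m : ℕ) :
    (List.range' s m).map (fun i => 2 * i + a) = List.range' (2 * s + a) m 2 := by
  apply List.ext_getElem <;> simp
  intro i _
  ring

end

theorem theta_eq_blockPerm {a b : ℕ} (hqp : b + 2 ≤ a + 2) (hpq : a + 2 ≤ b + 2 + 1) :
    theta (a + 2 + (b + 2)) = blockPerm hqp hpq (swap 0 1, swap 0 1) := by
  rw [← List.formPerm_pair, ← List.formPerm_pair, blockPerm_formPerm]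
  rfl

theorem eta_eq_blockPerm (k : ℕ) : eta (k + 1 + k) =
    blockPerm (Nat.le_succ k) le_rfl
      ((List.finRange (k + 1)).tail.formPerm, (List.finRange k).formPerm) := by
  rw [blockPerm_formPerm, map_val_finRange, map_val_tail_finRange, map_range'_two_mul,
    map_range'_two_mul, eta]
  congr 3 <;> omega

theorem zeta_eq_blockPerm (k : ℕ) : zeta (k + 1 + k) =
    blockPerm (Nat.le_succ k) le_rfl
      ((List.finRange (k + 1)).formPerm, (List.finRange k).tail.formPerm) := by
  rw [blockPerm_formPerm, map_val_finRange, map_val_tail_finRange, map_range'_two_mul,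
    map_range'_two_mul, zeta]
  congr 3 <;> omega

/-! ### Cycles through all points -/

theorem formPerm_finRange_apply {n : ℕ} (i : Fin n) (h : (i : ℕ) + 1 < n) :
    (List.finRange n).formPerm i = ⟨i + 1, h⟩ := by
  have := List.formPerm_apply_lt_getElem (List.finRange n) (List.nodup_finRange n) i (by simpa)
  simpa using this

theorem swap_mul_formPerm_tail_finRange (m : ℕ) :
    swap 0 1 * (List.finRange (m + 2)).tail.formPerm = (List.finRange (m + 2)).formPerm := by
  simp [List.finRange_succ]

theorem swap_mul_formPerm_finRange (m : ℕ) :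
    swap 0 1 * (List.finRange (m + 2)).formPerm = (List.finRange (m + 2)).tail.formPerm := by
  rw [← swap_mul_formPerm_tail_finRange, swap_mul_self_mul]

theorem isCycle_formPerm_finRange (m : ℕ) : (List.finRange (m + 2)).formPerm.IsCycle :=
  List.isCycle_formPerm (List.nodup_finRange _) (by simp)

theorem support_formPerm_finRange (m : ℕ) :
    (List.finRange (m + 2)).formPerm.support = Finset.univ := by
  rw [List.support_formPerm_of_nodup _ (List.nodup_finRange _)]
  · simp
  · intro x h
    simpa using congrArg List.length h

theorem sign_formPerm_finRange (m : ℕ) :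
    Perm.sign (List.finRange (m + 2)).formPerm = -(-1) ^ (m + 2) := by
  rw [(isCycle_formPerm_finRange m).sign, support_formPerm_finRange]
  simp

theorem closure_formPerm_finRange (m : ℕ) :
    Subgroup.closure {(List.finRange (m + 2)).formPerm, swap 0 1} = ⊤ := by
  have h := Perm.closure_cycle_adjacent_swap (isCycle_formPerm_finRange m)
    (support_formPerm_finRange m) 0
  rwa [formPerm_finRange_apply 0 (by simp)] at h

theorem closure_finRotate (m : ℕ) :
    Subgroup.closure {finRotate (m + 2), swap 0 1} = ⊤ := by
  have h := Perm.closure_cycle_adjacent_swap isCycle_finRotate support_finRotate (0 : Fin (m + 2))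
  simpa using h

/-! ### Even elements of `Γ_n`, and odd `n` -/

theorem exists_blockPerm_of_sign_eq_one {p q : ℕ} (hp : 0 < p) (hqp : q ≤ p) (hpq : p ≤ q + 1)
    {σ : Perm (Fin (p + q))} (hσ : σ ∈ Gamma (p + q)) (hs : Perm.sign σ = 1) :
    ∃ g, Perm.sign g.1 = Perm.sign g.2 ∧ blockPerm hqp hpq g = σ := by
  obtain ⟨g, rfl⟩ := exists_blockPerm_eq hqp hpq (σ := σ) fun i => by
    have h := (mem_Gamma_iff (by omega) σ).1 hσ i
    rw [hs] at h
    exact (neg_one_pow_eq_one_iff_even (by decide)).1 h.symm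
  exact ⟨g, (blockPerm_mem_Gamma_iff hqp hpq hp g).1 hσ, rfl⟩

/-- For odd `n` all elements of `Γ_n` are even: the displacements of a permutation add up to `0`, so
an odd number of them cannot all be odd. -/
theorem sign_eq_one_of_mem_Gamma {n : ℕ} (hn : Odd n) {σ : Perm (Fin n)} (hσ : σ ∈ Gamma n) :
    Perm.sign σ = 1 := by
  have h := Finset.prod_congr rfl fun i (_ : i ∈ Finset.univ) => (mem_Gamma_iff hn.pos σ).1 hσ i
  rw [Finset.prod_const, Finset.prod_pow_eq_pow_sum, Finset.sum_add_distrib,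
    Equiv.sum_comp σ fun i => (i : ℕ), (Even.add_self _).neg_one_pow, Finset.card_univ,
    Fintype.card_fin] at h
  rcases Int.units_eq_one_or (Perm.sign σ) with h' | h'
  · exact h'
  · rw [h', hn.neg_one_pow] at h
    exact absurd h (by decide)

/-- For odd `n`, `Γ_n` is generated by the images of any set of pairs satisfying the conditions of
`mem_of_isThreeCycle`. -/
theorem Gamma_eq_closure_image (k : ℕ) {S : Set (Perm (Fin (k + 1)) × Perm (Fin k))}
    (hS : ∀ g ∈ S, Perm.sign g.1 = Perm.sign g.2)
    (h₁ : (Subgroup.closure S).map (MonoidHom.fst _ _) = ⊤)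
    (h₂ : (Subgroup.closure S).map (MonoidHom.snd _ _) = ⊤)
    {c : Perm (Fin (k + 1))} (hc : c.IsThreeCycle) (hcS : (c, 1) ∈ Subgroup.closure S) :
    Gamma (k + 1 + k) = Subgroup.closure (blockPerm (Nat.le_succ k) le_rfl '' S) := by
  rw [← MonoidHom.map_closure]
  have hle : Subgroup.closure S ≤ MonoidHom.eqLocus
      ((Perm.sign (α := Fin (k + 1))).comp (MonoidHom.fst _ _))
      ((Perm.sign (α := Fin k)).comp (MonoidHom.snd _ _)) :=
    (Subgroup.closure_le _).2 hS
  have hsign : ∀ g ∈ Subgroup.closure S, Perm.sign g.1 = Perm.sign g.2 := fun g hg => hle hg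
  refine le_antisymm (fun σ hσ => ?_) ?_
  · obtain ⟨g, hg, rfl⟩ := exists_blockPerm_of_sign_eq_one (Nat.succ_pos k) (Nat.le_succ k) le_rfl
      hσ (sign_eq_one_of_mem_Gamma ⟨k, by omega⟩ hσ)
    exact ⟨g, mem_of_isThreeCycle hsign h₁ h₂ hc hcS g hg, rfl⟩
  · rintro _ ⟨g, hg, rfl⟩
    exact (blockPerm_mem_Gamma_iff _ _ (Nat.succ_pos k) g).2 (hsign g hg)

/-- For `m = 1`, which is the case `n = 7`, the second factor acts on three points only and has no
disjoint transpositions. -/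
theorem exists_isThreeCycle_mem {m : ℕ} (hm : m = 0 ∨ 2 ≤ m)
    {K : Subgroup (Perm (Fin (m + 3)) × Perm (Fin (m + 2)))} (hθ : (swap 0 1, swap 0 1) ∈ K)
    (hη : ((List.finRange (m + 3)).tail.formPerm, (List.finRange (m + 2)).formPerm) ∈ K) :
    ∃ c : Perm (Fin (m + 3)), c.IsThreeCycle ∧ (c, 1) ∈ K := by
  rcases hm with rfl | hm
  · refine ⟨(List.finRange 3).formPerm, ?_, ?_⟩
    · rw [← card_support_eq_three_iff, support_formPerm_finRange]
      rfl
    · have h := K.mul_mem hθ hη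
      rw [Prod.mk_mul_mk, swap_mul_formPerm_tail_finRange (0 + 1)] at h
      convert h using 2
      decide
  · obtain ⟨m, rfl⟩ := Nat.exists_eq_add_of_le' hm
    -- The conjugate of `(0 1)(0 1)` by the square of the second element is `(0 3)(2 3)`; on the
    -- second factor it commutes with `(0 1)(0 1)`.
    have h := K.mul_mem (K.mul_mem (K.mul_mem hη hη) hθ) (K.inv_mem (K.mul_mem hη hη))
    rw [← swap_mul_formPerm_finRange] at h
    simp only [Prod.mk_mul_mk, Prod.inv_mk, ← swap_apply_apply] at h
    have r0 : (List.finRange (m + 2 + 2)).formPerm 0 = 1 := formPerm_finRange_apply _ (by simp)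
    have r1 : (List.finRange (m + 2 + 2)).formPerm 1 = 2 := formPerm_finRange_apply _ (by simp)
    have r2 : (List.finRange (m + 2 + 2)).formPerm 2 = 3 :=
      formPerm_finRange_apply ⟨2, by omega⟩ (by simp)
    have t0 : (List.finRange (m + 3 + 2)).formPerm 0 = 1 := formPerm_finRange_apply _ (by simp)
    have t1 : (List.finRange (m + 3 + 2)).formPerm 1 = 2 := formPerm_finRange_apply _ (by simp)
    have t2 : (List.finRange (m + 3 + 2)).formPerm 2 = 3 :=
      formPerm_finRange_apply ⟨2, by omega⟩ (by simp)
    have h20 : (2 : Fin (m + 3 + 2)) ≠ 0 := Fin.ne_of_val_ne (by decide : (2 : ℕ) ≠ 0)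
    have h21 : (2 : Fin (m + 3 + 2)) ≠ 1 := Fin.ne_of_val_ne (by decide : (2 : ℕ) ≠ 1)
    have h30 : (3 : Fin (m + 3 + 2)) ≠ 0 := Fin.ne_of_val_ne (by decide : (3 : ℕ) ≠ 0)
    have h31 : (3 : Fin (m + 3 + 2)) ≠ 1 := Fin.ne_of_val_ne (by decide : (3 : ℕ) ≠ 1)
    have k20 : (2 : Fin (m + 2 + 2)) ≠ 0 := Fin.ne_of_val_ne (by decide : (2 : ℕ) ≠ 0)
    have k21 : (2 : Fin (m + 2 + 2)) ≠ 1 := Fin.ne_of_val_ne (by decide : (2 : ℕ) ≠ 1)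
    have k30 : (3 : Fin (m + 2 + 2)) ≠ 0 := Fin.ne_of_val_ne (by decide : (3 : ℕ) ≠ 0)
    have k31 : (3 : Fin (m + 2 + 2)) ≠ 1 := Fin.ne_of_val_ne (by decide : (3 : ℕ) ≠ 1)
    simp only [Perm.mul_apply, r0, r1, r2, t0, t1, t2, swap_apply_right,
      swap_apply_of_ne_of_ne h20 h21, swap_apply_of_ne_of_ne h30 h31] at h
    have h' := K.mul_mem hθ h
    have hcomm : Commute (swap (0 : Fin (m + 2 + 2)) 1) (swap 2 3) := by
      rw [commute_iff_eq, mul_swap_eq_swap_mul, swap_apply_of_ne_of_ne k20 k21,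
        swap_apply_of_ne_of_ne k30 k31]
    refine ⟨_, (Perm.isThreeCycle_swap_mul_swap_same (by simp) h30.symm
      h31.symm).isThreeCycle_sq, ?_⟩
    have h'' := K.mul_mem h' h'
    have hsq : (swap (0 : Fin (m + 2 + 2)) 1 * swap 2 3) * (swap 0 1 * swap 2 3) = 1 := by
      rw [mul_assoc, hcomm.symm.left_comm, swap_mul_self_mul, swap_mul_self]
    rwa [Prod.mk_mul_mk, Prod.mk_mul_mk, hsq] at h''

theorem sign_tail_eq (m : ℕ) : Perm.sign (List.finRange (m + 3)).tail.formPerm =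
    Perm.sign (List.finRange (m + 2)).formPerm := by
  rw [← swap_mul_formPerm_finRange (m + 1), map_mul, sign_formPerm_finRange,
    sign_formPerm_finRange, Perm.sign_swap (by simp)]
  simp [pow_succ]

theorem map_fst_eq_top {m : ℕ} {K : Subgroup (Perm (Fin (m + 3)) × Perm (Fin (m + 2)))}
    {u : Perm (Fin (m + 3)) × Perm (Fin (m + 2))} (hu : u ∈ K)
    (hu' : u.1 = (List.finRange (m + 3)).tail.formPerm) (hθ : (swap 0 1, swap 0 1) ∈ K) :
    K.map (MonoidHom.fst _ _) = ⊤ := by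
  refine map_closure_eq_top _ (K.mul_mem hθ hu) hθ ?_
  simp only [MonoidHom.coe_fst, Prod.fst_mul, hu']
  rw [swap_mul_formPerm_tail_finRange (m + 1)]
  exact closure_formPerm_finRange (m + 1)

theorem Gamma_eq_closure_theta_eta {m : ℕ} (hm : m = 0 ∨ 2 ≤ m) :
    Gamma (m + 3 + (m + 2)) =
      Subgroup.closure {theta (m + 3 + (m + 2)), eta (m + 3 + (m + 2))} := by
  have hθ := theta_eq_blockPerm (a := m + 1) (b := m) (by omega) (by omega)
  have hη := eta_eq_blockPerm (m + 2)
  rw [hθ, hη, ← Set.image_pair]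
  have h₁ := Subgroup.subset_closure (Set.mem_insert (swap 0 1, swap 0 1)
    {((List.finRange (m + 3)).tail.formPerm, (List.finRange (m + 2)).formPerm)})
  have h₂ := Subgroup.subset_closure (Set.mem_insert_of_mem (swap 0 1, swap 0 1)
    (Set.mem_singleton ((List.finRange (m + 3)).tail.formPerm, (List.finRange (m + 2)).formPerm)))
  obtain ⟨c, hc, hcS⟩ := exists_isThreeCycle_mem hm h₁ h₂
  refine Gamma_eq_closure_image (m + 2) ?_ (map_fst_eq_top h₂ rfl h₁)
    (map_closure_eq_top _ h₂ h₁ (closure_formPerm_finRange m)) hc hcS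
  rintro _ (rfl | rfl)
  · rw [Perm.sign_swap (by simp), Perm.sign_swap (by simp)]
  · exact sign_tail_eq m

theorem theta_mul_eta (m : ℕ) : theta (m + 3 + (m + 2)) * eta (m + 3 + (m + 2)) =
    zeta (m + 3 + (m + 2)) := by
  have hθ := theta_eq_blockPerm (a := m + 1) (b := m) (by omega) (by omega)
  have hη := eta_eq_blockPerm (m + 2)
  have hζ := zeta_eq_blockPerm (m + 2)
  rw [hθ, hη, hζ, ← map_mul, Prod.mk_mul_mk, swap_mul_formPerm_finRange]
  congr 2
  exact swap_mul_formPerm_tail_finRange (m + 1)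

theorem closure_pair_mul_right {G : Type*} [Group G] (a b : G) :
    Subgroup.closure {a, a * b} = Subgroup.closure {a, b} := by
  have h : ∀ b : G, Subgroup.closure {a, a * b} ≤ Subgroup.closure {a, b} := fun b => by
    rw [Subgroup.closure_le]
    have ha : a ∈ Subgroup.closure {a, b} := Subgroup.subset_closure (by simp)
    have hb : b ∈ Subgroup.closure {a, b} := Subgroup.subset_closure (by simp)
    rintro _ (rfl | rfl)
    exacts [ha, mul_mem ha hb]
  refine le_antisymm (h b) ?_
  rw [Subgroup.closure_le]
  have ha : a ∈ Subgroup.closure {a, a * b} := Subgroup.subset_closure (by simp)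
  have hb : a * b ∈ Subgroup.closure {a, a * b} := Subgroup.subset_closure (by simp)
  rintro _ (rfl | rfl)
  exacts [ha, by simpa using mul_mem (inv_mem ha) hb]

theorem theta_mul_eta_ne (m : ℕ) : theta (m + 3 + (m + 2)) * eta (m + 3 + (m + 2)) ≠
    eta (m + 3 + (m + 2)) * theta (m + 3 + (m + 2)) := by
  have hθ := theta_eq_blockPerm (a := m + 1) (b := m) (by omega) (by omega)
  have hη := eta_eq_blockPerm (m + 2)
  rw [hθ, hη, ← map_mul, ← map_mul]
  intro h
  have h' := congrArg (fun g => g.1 0) (blockPerm_injective _ _ h)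
  have t0 : (List.finRange (m + 1 + 2)).formPerm 0 = 1 := formPerm_finRange_apply _ (by simp)
  have t1 : (List.finRange (m + 1 + 2)).formPerm 1 = 2 :=
    formPerm_finRange_apply _ (by simp)
  have h20 : (2 : Fin (m + 1 + 2)) ≠ 0 := Fin.ne_of_val_ne (by decide : (2 : ℕ) ≠ 0)
  have h21 : (2 : Fin (m + 1 + 2)) ≠ 1 := Fin.ne_of_val_ne (by decide : (2 : ℕ) ≠ 1)
  have e : (List.finRange (m + 3)).tail.formPerm =
      swap 0 1 * (List.finRange (m + 1 + 2)).formPerm :=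
    (swap_mul_formPerm_finRange (m + 1)).symm
  rw [e] at h'
  change swap 0 1 (swap 0 1 ((List.finRange (m + 1 + 2)).formPerm 0)) =
    swap 0 1 ((List.finRange (m + 1 + 2)).formPerm (swap 0 1 0)) at h'
  rw [swap_apply_left, t0, t1, swap_apply_right, swap_apply_left,
    swap_apply_of_ne_of_ne h20 h21] at h'
  exact h21 h'.symm

/-! ### Even `n` -/

section

variable {k : ℕ}

theorem finRotate_interleave_inl (i : Fin k) :
    finRotate (k + k) (interleave le_rfl (Nat.le_succ k) (Sum.inl i)) =
      interleave le_rfl (Nat.le_succ k) (Sum.inr i) := by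
  have h := interleave_inl le_rfl (Nat.le_succ k) i
  apply Fin.ext
  rw [interleave_inr]
  generalize interleave le_rfl (Nat.le_succ k) (Sum.inl i) = j at h
  have hi := i.isLt
  obtain ⟨n, hn⟩ : ∃ n, k + k = n + 1 := ⟨k + k - 1, by omega⟩
  generalize hN : k + k = N at j hn
  subst hn
  rw [coe_finRotate, if_neg, h]
  rw [Fin.ext_iff, Fin.val_last]
  omega

theorem finRotate_interleave_inr (i : Fin k) :
    finRotate (k + k) (interleave le_rfl (Nat.le_succ k) (Sum.inr i)) =
      interleave le_rfl (Nat.le_succ k) (Sum.inl (finRotate k i)) := by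
  have h := interleave_inr le_rfl (Nat.le_succ k) i
  apply Fin.ext
  rw [interleave_inl]
  generalize interleave le_rfl (Nat.le_succ k) (Sum.inr i) = j at h
  have hi := i.isLt
  obtain ⟨m, rfl⟩ : ∃ m, k = m + 1 := ⟨k - 1, by omega⟩
  rw [coe_finRotate]
  have h' := coe_finRotate (n := m + 1 + m) j
  refine h'.trans ?_
  simp only [Fin.ext_iff, Fin.val_last, h]
  split_ifs <;> omega

/-- The full cycle interchanges the two parity classes: it takes the even values to the odd ones
identically, and the odd values to the even ones by a rotation. -/
theorem finRotate_mul_blockPerm (x y : Perm (Fin k)) :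
    finRotate (k + k) * blockPerm le_rfl (Nat.le_succ k) (x, y) * (finRotate (k + k))⁻¹ =
      blockPerm le_rfl (Nat.le_succ k) (finRotate k * y * (finRotate k)⁻¹, x) := by
  rw [mul_inv_eq_iff_eq_mul]
  ext i : 1
  obtain ⟨i | i, rfl⟩ := (interleave le_rfl (Nat.le_succ k)).surjective i
  · simp only [Perm.mul_apply, finRotate_interleave_inl, blockPerm_inl, blockPerm_inr]
  · simp only [Perm.mul_apply, finRotate_interleave_inr, blockPerm_inl, blockPerm_inr,
      Perm.coe_inv, symm_apply_apply]

theorem finRotate_mul_self : finRotate (k + k) * finRotate (k + k) =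
    blockPerm le_rfl (Nat.le_succ k) (finRotate k, finRotate k) := by
  ext i : 1
  obtain ⟨i | i, rfl⟩ := (interleave le_rfl (Nat.le_succ k)).surjective i
  · simp only [Perm.mul_apply, finRotate_interleave_inl, finRotate_interleave_inr, blockPerm_inl]
  · simp only [Perm.mul_apply, finRotate_interleave_inl, finRotate_interleave_inr, blockPerm_inr]

end

theorem sign_sigma (k : ℕ) : Perm.sign (sigma (k + 1 + (k + 1))) = -1 := by
  rw [sigma, sign_finRotate]
  exact Odd.neg_one_pow ⟨k, by omega⟩

theorem sigma_mem_Gamma (k : ℕ) : sigma (k + 1 + (k + 1)) ∈ Gamma (k + 1 + (k + 1)) := by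
  rw [mem_Gamma_iff (by omega)]
  intro i
  rw [sign_sigma, eq_comm]
  refine Odd.neg_one_pow ?_
  rw [sigma]
  obtain ⟨i | i, rfl⟩ := (interleave le_rfl (Nat.le_succ (k + 1))).surjective i
  · rw [finRotate_interleave_inl, interleave_inl, interleave_inr]
    exact ⟨i + i, by omega⟩
  · rw [finRotate_interleave_inr, interleave_inl, interleave_inr]
    exact ⟨finRotate (k + 1) i + i, by omega⟩

theorem finRotate_zero_one_two (m : ℕ) : finRotate (m + 3) * swap 0 1 * (finRotate (m + 3))⁻¹ =
    swap 1 2 := by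
  rw [← swap_apply_apply, finRotate_apply, finRotate_apply, zero_add]
  rfl

theorem Gamma_eq_closure_theta_sigma (m : ℕ) : Gamma (m + 3 + (m + 3)) =
    Subgroup.closure {theta (m + 3 + (m + 3)), sigma (m + 3 + (m + 3))} := by
  set L := Subgroup.closure {theta (m + 3 + (m + 3)), sigma (m + 3 + (m + 3))} with hL
  have hθ := theta_eq_blockPerm (a := m + 1) (b := m + 1) le_rfl (Nat.le_succ _)
  have hθL : theta (m + 3 + (m + 3)) ∈ L := Subgroup.subset_closure (by simp)
  have hσL : sigma (m + 3 + (m + 3)) ∈ L := Subgroup.subset_closure (by simp)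
  have hle : L ≤ Gamma (m + 3 + (m + 3)) := by
    rw [hL, Subgroup.closure_le]
    rintro _ (rfl | rfl)
    · rw [hθ]
      refine (blockPerm_mem_Gamma_iff _ _ (Nat.succ_pos _) _).2 ?_
      simp
    · exact sigma_mem_Gamma (m + 2)
  set K := L.comap (blockPerm le_rfl (Nat.le_succ (m + 3))) with hK
  have h₁ : (swap 0 1, swap 0 1) ∈ K := by
    rw [hK, Subgroup.mem_comap]
    exact hθ ▸ hθL
  have h₂ : (finRotate (m + 3), finRotate (m + 3)) ∈ K := by
    rw [hK, Subgroup.mem_comap, ← finRotate_mul_self]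
    exact mul_mem hσL hσL
  have h₃ : (swap 1 2, swap 0 1) ∈ K := by
    rw [hK, Subgroup.mem_comap, ← finRotate_zero_one_two, ← finRotate_mul_blockPerm]
    exact mul_mem (mul_mem hσL h₁) (inv_mem hσL)
  have h20 : (2 : Fin (m + 3)) ≠ 0 := Fin.ne_of_val_ne (by decide : (2 : ℕ) ≠ 0)
  have h21 : (2 : Fin (m + 3)) ≠ 1 := Fin.ne_of_val_ne (by decide : (2 : ℕ) ≠ 1)
  have hc : (swap (0 : Fin (m + 3)) 1 * swap 1 2).IsThreeCycle := by
    rw [swap_comm (0 : Fin (m + 3)) 1]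
    exact Perm.isThreeCycle_swap_mul_swap_same (by simp) h21.symm h20.symm
  have hcK : (swap (0 : Fin (m + 3)) 1 * swap 1 2, 1) ∈ K := by
    have h := mul_mem h₁ h₃
    rwa [Prod.mk_mul_mk, swap_mul_self] at h
  have hgen : ∀ g : Perm (Fin (m + 3)) × Perm (Fin (m + 3)),
      Perm.sign g.1 = Perm.sign g.2 → g ∈ K :=
    mem_of_isThreeCycle
      (fun g hg => (blockPerm_mem_Gamma_iff le_rfl (Nat.le_succ _) (Nat.succ_pos _) g).1 (hle hg))
      (map_closure_eq_top _ h₂ h₁ (closure_finRotate (m + 1)))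
      (map_closure_eq_top _ h₂ h₁ (closure_finRotate (m + 1))) hc hcK
  -- Elements of sign `-1` interchange the parity classes, as `sigma` does, and are reduced to
  -- those of sign `1` by multiplication with its inverse.
  have hone : ∀ τ ∈ Gamma (m + 3 + (m + 3)), Perm.sign τ = 1 → τ ∈ L := by
    intro τ hτ hs
    obtain ⟨g, hg, rfl⟩ := exists_blockPerm_of_sign_eq_one (Nat.succ_pos _) le_rfl
      (Nat.le_succ _) hτ hs
    exact hgen g hg
  refine le_antisymm (fun τ hτ => ?_) hle
  rcases Int.units_eq_one_or (Perm.sign τ) with hs | hs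
  · exact hone τ hτ hs
  · have h := hone ((sigma (m + 3 + (m + 3)))⁻¹ * τ)
      (mul_mem (inv_mem (sigma_mem_Gamma (m + 2))) hτ) (by
        rw [map_mul, map_inv, sign_sigma (m + 2), hs]
        rfl)
    simpa using mul_mem hσL h

theorem theta_mul_sigma_ne (m : ℕ) :
    theta (m + 3 + (m + 3)) * sigma (m + 3 + (m + 3)) ≠
      sigma (m + 3 + (m + 3)) * theta (m + 3 + (m + 3)) := by
  have hθ := theta_eq_blockPerm (a := m + 1) (b := m + 1) le_rfl (Nat.le_succ _)
  intro h
  rw [eq_comm, ← mul_inv_eq_iff_eq_mul, hθ, sigma,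
    finRotate_mul_blockPerm, finRotate_zero_one_two] at h
  have h' := congrArg (fun g => g.1 0) (blockPerm_injective _ _ h)
  have h20 : (2 : Fin (m + 3)) ≠ 0 := Fin.ne_of_val_ne (by decide : (2 : ℕ) ≠ 0)
  change swap (1 : Fin (m + 3)) 2 0 = swap 0 1 0 at h'
  rw [swap_apply_left, swap_apply_of_ne_of_ne (by simp) h20.symm] at h'
  simp at h'

/-! ### The cases `n = 4` and `n = 7` -/

theorem Gamma_four : Gamma 4 = Subgroup.zpowers (sigma 4) := by
  refine le_antisymm (fun τ hτ => ?_) ?_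
  · have h : ∀ τ : Perm (Fin 4), (∀ i, Perm.sign τ = (-1) ^ ((τ i : ℕ) + (i : ℕ))) →
        ∃ j : Fin 4, finRotate 4 ^ (j : ℕ) = τ := by
      decide +kernel
    obtain ⟨j, hj⟩ := h τ ((mem_Gamma_iff (by norm_num) τ).1 hτ)
    exact hj ▸ Subgroup.npow_mem_zpowers _ _
  · rw [Subgroup.zpowers_le]
    exact sigma_mem_Gamma 1

theorem card_Gamma_four : Nat.card (Gamma 4) = 4 := by
  rw [Gamma_four, Nat.card_zpowers, sigma, isCycle_finRotate.orderOf, support_finRotate]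
  rfl

theorem cyc_seven_odd : cyc 7 [3, 5, 7] =
    blockPerm (p := 4) (q := 3) (by norm_num) le_rfl ((List.finRange 4).tail.formPerm, 1) :=
  (blockPerm_formPerm_inl (p := 4) (q := 3) (by norm_num) le_rfl (List.finRange 4).tail).symm

theorem cyc_seven_even : cyc 7 [2, 4, 6] =
    blockPerm (p := 4) (q := 3) (by norm_num) le_rfl (1, (List.finRange 3).formPerm) :=
  (blockPerm_formPerm_inr (p := 4) (q := 3) (by norm_num) le_rfl (List.finRange 3)).symm

theorem isThreeCycle_formPerm_tail_finRange_four :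
    (List.finRange 4).tail.formPerm.IsThreeCycle := by
  rw [← card_support_eq_three_iff]
  decide

theorem Gamma_seven : Gamma 7 =
    Subgroup.closure {cyc 7 [1, 3] * cyc 7 [2, 4], cyc 7 [3, 5, 7], cyc 7 [2, 4, 6]} := by
  have hθ : cyc 7 [1, 3] * cyc 7 [2, 4] = _ :=
    theta_eq_blockPerm (a := 2) (b := 1) (by norm_num) le_rfl
  rw [hθ, cyc_seven_odd, cyc_seven_even, ← Set.image_pair, ← Set.image_insert_eq]
  have h₁ : ((swap 0 1, swap 0 1) : Perm (Fin 4) × Perm (Fin 3)) ∈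
      Subgroup.closure {(swap 0 1, swap 0 1), ((List.finRange 4).tail.formPerm, 1),
        (1, (List.finRange 3).formPerm)} := Subgroup.subset_closure (by simp)
  have h₂ : (((List.finRange 4).tail.formPerm, 1) : Perm (Fin 4) × Perm (Fin 3)) ∈
      Subgroup.closure {(swap 0 1, swap 0 1), ((List.finRange 4).tail.formPerm, 1),
        (1, (List.finRange 3).formPerm)} := Subgroup.subset_closure (by simp)
  have h₃ : ((1, (List.finRange 3).formPerm) : Perm (Fin 4) × Perm (Fin 3)) ∈
      Subgroup.closure {(swap 0 1, swap 0 1), ((List.finRange 4).tail.formPerm, 1),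
        (1, (List.finRange 3).formPerm)} := Subgroup.subset_closure (by simp)
  refine Gamma_eq_closure_image 3 ?_ (map_fst_eq_top h₂ rfl h₁)
    (map_closure_eq_top _ h₃ h₁ (closure_formPerm_finRange 1))
    isThreeCycle_formPerm_tail_finRange_four h₂
  rintro _ (rfl | rfl | rfl) <;> decide

/-- The homomorphism from the symmetric group on four points onto the symmetric group on three
points, given by the action on the three partitions of `{0, 1, 2, 3}` into two pairs. The partition
in which `0` and `a` form a pair is identified by the number `a - 1`. If `{x, y}` is a pair of a
partition, then the partner of `0` in it is the bitwise sum of `x` and `y`. -/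
def pairPartitionHom : Perm (Fin 4) →* Perm (Fin 3) :=
  let f : Perm (Fin 4) → Fin 3 → Fin 3 := fun g i =>
    Fin.ofNat 3 ((((g 0 : ℕ) ^^^ (g i.succ : ℕ)) - 1))
  { toFun := fun g =>
      { toFun := f g
        invFun := f g⁻¹
        left_inv := by revert g; decide +kernel
        right_inv := by revert g; decide +kernel }
    map_one' := by decide +kernel
    map_mul' := by decide +kernel }

theorem sign_pairPartitionHom : ∀ g, Perm.sign (pairPartitionHom g) = Perm.sign g := by
  decide +kernel

/-- The pairs of permutations of four and of three points that have equal sign. -/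
def equalSign : Subgroup (Perm (Fin 4) × Perm (Fin 3)) :=
  MonoidHom.eqLocus (Perm.sign.comp (MonoidHom.fst _ _)) (Perm.sign.comp (MonoidHom.snd _ _))

theorem mem_equalSign {g : Perm (Fin 4) × Perm (Fin 3)} :
    g ∈ equalSign ↔ Perm.sign g.1 = Perm.sign g.2 := Iff.rfl

/-- Twelve homomorphisms from `equalSign` to the symmetric group on three points: the two
projections (the first one followed by `pairPartitionHom`), composed with inner automorphisms. -/
def twistedProj (x : Perm (Fin 3) × Bool) : equalSign →* Perm (Fin 3) :=
  (MulAut.conj x.1).toMonoidHom.comp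
    ((bif x.2 then MonoidHom.snd _ _ else pairPartitionHom.comp (MonoidHom.fst _ _)).comp
      equalSign.subtype)

theorem sign_twistedProj (x : Perm (Fin 3) × Bool) (g : equalSign) :
    Perm.sign (twistedProj x g) = Perm.sign g.1.2 := by
  have h : Perm.sign g.1.1 = Perm.sign g.1.2 := g.2
  obtain ⟨c, b⟩ := x
  cases b <;> simp [twistedProj, sign_pairPartitionHom, h, mul_right_comm]

theorem twistedProj_injective : Function.Injective twistedProj := by
  have key : ∀ x y : Perm (Fin 3) × Bool,
      twistedProj x ⟨(swap 1 2 * swap 2 3, 1), mem_equalSign.2 (by decide)⟩ =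
        twistedProj y ⟨(swap 1 2 * swap 2 3, 1), mem_equalSign.2 (by decide)⟩ →
      twistedProj x ⟨(1, swap 0 1 * swap 1 2), mem_equalSign.2 (by decide)⟩ =
        twistedProj y ⟨(1, swap 0 1 * swap 1 2), mem_equalSign.2 (by decide)⟩ →
      twistedProj x ⟨(swap 0 1, swap 0 1), mem_equalSign.2 (by decide)⟩ =
        twistedProj y ⟨(swap 0 1, swap 0 1), mem_equalSign.2 (by decide)⟩ → x = y := by
    decide +kernel
  intro x y h
  exact key x y (by rw [h]) (by rw [h]) (by rw [h])

/-- The values of a `twistedProj` on two given elements have prescribed signs, so at most `3 * 3`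
pairs of values occur; as there are twelve such homomorphisms, two of them agree on the two
elements, which therefore do not generate. -/
theorem two_lt_rank_equalSign : 2 < Group.rank equalSign := by
  by_contra! hle
  obtain ⟨S, hS, hS'⟩ := Group.rank_spec equalSign
  obtain ⟨g, h, hgh⟩ : ∃ g h, S ⊆ {g, h} := by
    rcases (hS.trans_le hle).lt_or_eq with hlt | heq
    · obtain ⟨g, hg⟩ := Finset.card_le_one_iff_subset_singleton.1 (Nat.le_of_lt_succ hlt)
      exact ⟨g, g, by simpa using hg⟩
    · obtain ⟨g, h, -, rfl⟩ := Finset.card_eq_two.1 heq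
      exact ⟨g, h, subset_rfl⟩
  have hcard : ∀ s t : ℤˣ, ((Finset.univ.filter fun u : Perm (Fin 3) => Perm.sign u = s) ×ˢ
      (Finset.univ.filter fun u : Perm (Fin 3) => Perm.sign u = t)).card <
        (Finset.univ : Finset (Perm (Fin 3) × Bool)).card := by
    decide +kernel
  obtain ⟨x, -, y, -, hxy, he⟩ := Finset.exists_ne_map_eq_of_card_lt_of_maps_to
    (f := fun x => (twistedProj x g, twistedProj x h))
    (hcard (Perm.sign g.1.2) (Perm.sign h.1.2)) (fun x _ => by simp [sign_twistedProj])
  rw [Prod.mk.injEq] at he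
  refine hxy (twistedProj_injective (MonoidHom.eq_of_eqOn_dense hS' fun u hu => ?_))
  have hu' := hgh hu
  rw [Finset.mem_insert, Finset.mem_singleton] at hu'
  rcases hu' with rfl | rfl
  exacts [he.1, he.2]

theorem Gamma_seven_eq_map : Gamma 7 =
    equalSign.map (blockPerm (p := 4) (q := 3) (by norm_num) le_rfl) := by
  refine le_antisymm (fun σ hσ => ?_) ?_
  · obtain ⟨g, hg, rfl⟩ := exists_blockPerm_of_sign_eq_one (p := 4) (q := 3) (by norm_num)
      (by norm_num) le_rfl hσ (sign_eq_one_of_mem_Gamma (by decide) hσ)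
    exact ⟨g, hg, rfl⟩
  · rintro _ ⟨g, hg, rfl⟩
    exact (blockPerm_mem_Gamma_iff (p := 4) (q := 3) _ _ (by norm_num) g).2 hg

theorem rank_Gamma_seven : Group.rank (Gamma 7) = 3 := by
  refine le_antisymm ?_ ?_
  · rw [Subgroup.rank_congr Gamma_seven]
    refine (Subgroup.rank_closure_finite_le_nat_card _).trans ?_
    rw [Nat.card_coe_set_eq]
    exact (Set.ncard_insert_le _ _).trans (Nat.succ_le_succ
      ((Set.ncard_insert_le _ _).trans (by rw [Set.ncard_singleton])))
  · rw [Subgroup.rank_congr Gamma_seven_eq_map, ← Group.rank_congr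
      (equalSign.equivMapOfInjective _ (blockPerm_injective _ _))]
    exact two_lt_rank_equalSign

end EvenRestriction

theorem theorem2p5 :
    (∀ n : ℕ, Odd n → (n = 5 ∨ 9 ≤ n) →
      EvenRestriction.Gamma n =
          Subgroup.closure {EvenRestriction.theta n, EvenRestriction.eta n} ∧
        EvenRestriction.Gamma n =
          Subgroup.closure {EvenRestriction.theta n, EvenRestriction.zeta n} ∧
        Group.rank (EvenRestriction.Gamma n) = 2) ∧
    (∀ n : ℕ, Even n → 6 ≤ n →
      EvenRestriction.Gamma n =
          Subgroup.closure {EvenRestriction.theta n, EvenRestriction.sigma n} ∧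
        Group.rank (EvenRestriction.Gamma n) = 2) ∧
    (EvenRestriction.Gamma 4 = Subgroup.zpowers (EvenRestriction.sigma 4) ∧
      Nat.card (EvenRestriction.Gamma 4) = 4) ∧
    (EvenRestriction.Gamma 7 =
        Subgroup.closure {EvenRestriction.cyc 7 [1, 3] * EvenRestriction.cyc 7 [2, 4],
          EvenRestriction.cyc 7 [3, 5, 7], EvenRestriction.cyc 7 [2, 4, 6]} ∧
      Group.rank (EvenRestriction.Gamma 7) = 3) := by
  refine ⟨fun n hn hn' => ?_, fun n hn hn' => ?_,
    ⟨EvenRestriction.Gamma_four, EvenRestriction.card_Gamma_four⟩,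
    EvenRestriction.Gamma_seven, EvenRestriction.rank_Gamma_seven⟩
  · obtain ⟨m, hm, rfl⟩ : ∃ m, (m = 0 ∨ 2 ≤ m) ∧ n = m + 3 + (m + 2) := by
      obtain ⟨k, rfl⟩ := hn
      exact ⟨k - 2, by omega, by omega⟩
    have h := EvenRestriction.Gamma_eq_closure_theta_eta hm
    refine ⟨h, ?_, EvenRestriction.rank_eq_two h (EvenRestriction.theta_mul_eta_ne m)⟩
    rw [h, ← EvenRestriction.theta_mul_eta, EvenRestriction.closure_pair_mul_right]
  · obtain ⟨m, rfl⟩ : ∃ m, n = m + 3 + (m + 3) := by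
      obtain ⟨k, rfl⟩ := hn
      exact ⟨k - 3, by omega⟩
    have h := EvenRestriction.Gamma_eq_closure_theta_sigma m
    exact ⟨h, EvenRestriction.rank_eq_two h (EvenRestriction.theta_mul_sigma_ne m)⟩
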